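/- **Theorem 3.1.** Let $k$ be an algebraically closed field, let $N\cong\mathbb Z^n$ be a lattice of finite rank with dual lattice $M=\operatorname{Hom}(N,\mathbb Z)$, and put $N_{\mathbb R}=N\otimes_{\mathbb Z}\mathbb R$. Let $\Delta$ be a fan in $N_{\mathbb R}$, that is, a nonempty finite collection of strongly convex rational polyhedral cones in $N_{\mathbb R}$ such that every face of a cone of $\Delta$ belongs to $\Delta$, and such that the intersection of any two cones of $\Delta$ is a face of both. (A face of $\sigma$ is a set of the form $\sigma\cap u^{\perp}$, where $u$ is a linear functional on $N_{\mathbb R}$ that is nonnegative on $\sigma$.) For $\sigma\in\Delta$ let $S_\sigma=\{m\in M : (m,v)\ge 0 \text{ for all } v\in\sigma\}$ and $U_\sigma=\operatorname{Spec} k[S_\sigma]$, and let $X=X(\Delta)$ be the toric variety over $k$ obtained by gluing the affine varieties $U_\sigma$, $\sigma\in\Delta$, along their open subvarieties $U_{\sigma\cap\tau}$. It contains the torus $T=U_{\{0\}}=\operatorname{Spec} k[M]$ as an open dense subset. Suppose that $X$ has a structure of a toric semigroup, that is, that there is an associative morphism $\mu\colon X\times X\to X$ of varieties over $k$ whose restriction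 to $T\times T$ is the multiplication of $T$. Then $\Delta$ is generated by a single cone: there is a $\sigma\in\Delta$ such that $\Delta$ consists of $\sigma$ together with all its faces. In particular, $X$ is affine. -/

import Mathlib

open CategoryTheory Limits AlgebraicGeometry MonoidalCategory
open scoped TensorProduct

universe u

namespace Toric

noncomputable section

/-! ### Cones and fans -/

/-- The real vector space `N_ℝ = ℝ ⊗ N` attached to a lattice `N`. -/
abbrev RealSpace (N : Type u) [AddCommGroup N] : Type u := ℝ ⊗[ℤ] N

section Cones

variable {N : Type u} [AddCommGroup N]

/-- A cone is strongly convex if it contains no real line (for a convex cone: no line through the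
origin). -/
def IsStronglyConvex (σ : PointedCone ℝ (RealSpace N)) : Prop :=
  ∀ v, v ∈ σ → -v ∈ σ → v = 0

/-- A cone is polyhedral if it is an intersection of finitely many closed half-spaces. -/
def IsPolyhedral (σ : PointedCone ℝ (RealSpace N)) : Prop :=
  ∃ s : Finset (Module.Dual ℝ (RealSpace N)), ∀ v, v ∈ σ ↔ ∀ u ∈ s, 0 ≤ u v

/-- A cone is rational if it is generated by finitely many elements of the lattice. -/
def IsRational (σ : PointedCone ℝ (RealSpace N)) : Prop :=
  ∃ s : Finset N, σ = PointedCone.hull ℝ ((fun n : N => (1 : ℝ) ⊗ₜ[ℤ] n) '' (s : Set N))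

/-- `IsFace τ σ`: the cone `τ` is a face of `σ`, i.e. `τ = σ ∩ u^⊥` for some real linear functional
`u` which is nonnegative on `σ`. -/
def IsFace (τ σ : PointedCone ℝ (RealSpace N)) : Prop :=
  ∃ u : Module.Dual ℝ (RealSpace N), (∀ v ∈ σ, 0 ≤ u v) ∧ ∀ v, v ∈ τ ↔ v ∈ σ ∧ u v = 0

end Cones

/-- A fan in `N_ℝ`. -/
structure Fan (N : Type u) [AddCommGroup N] where
  /-- The cones of the fan. -/
  cones : Set (PointedCone ℝ (RealSpace N))
  nonempty : cones.Nonempty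
  finite : cones.Finite
  stronglyConvex : ∀ σ ∈ cones, IsStronglyConvex σ
  polyhedral : ∀ σ ∈ cones, IsPolyhedral σ
  rational : ∀ σ ∈ cones, IsRational σ
  face_mem : ∀ σ ∈ cones, ∀ τ, IsFace τ σ → τ ∈ cones
  inter_face : ∀ σ ∈ cones, ∀ τ ∈ cones, IsFace (σ ⊓ τ) σ ∧ IsFace (σ ⊓ τ) τ

/-- The fan `Δ` is generated by `σ`: it consists of the cone `σ` together with all faces of `σ`. -/
def Fan.IsGeneratedBy {N : Type u} [AddCommGroup N] (Δ : Fan N)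
    (σ : PointedCone ℝ (RealSpace N)) : Prop :=
  σ ∈ Δ.cones ∧ ∀ τ, τ ∈ Δ.cones ↔ τ = σ ∨ IsFace τ σ

/-! ### The semigroups `S_σ` and their semigroup rings -/

section Semigroup

variable {N : Type u} [AddCommGroup N]

/-- The semigroup `S_σ = σ^* ∩ M` in the dual lattice `M = Hom(N, ℤ)`. -/
def dualMonoid (σ : PointedCone ℝ (RealSpace N)) : AddSubmonoid (Module.Dual ℤ N) where
  carrier := {m | ∀ v ∈ σ, 0 ≤ m.baseChange ℝ v}
  zero_mem' := fun v _ => by simp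
  add_mem' := fun {a b} ha hb v hv => by
    rw [map_add, LinearMap.add_apply]
    exact add_nonneg (ha v hv) (hb v hv)

lemma dualMonoid_anti {σ τ : PointedCone ℝ (RealSpace N)} (h : σ ≤ τ) :
    dualMonoid τ ≤ dualMonoid σ :=
  fun _ hm v hv => hm v (h hv)

/-- For the zero cone, `S_σ` is the whole lattice `M`. -/
lemma dualMonoid_bot : dualMonoid (⊥ : PointedCone ℝ (RealSpace N)) = ⊤ := by
  refine eq_top_iff.2 fun m _ v hv => ?_
  rw [(Submodule.mem_bot _).1 hv, map_zero]

/-- The semigroup ring `k[S_σ]`. -/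
abbrev SemigroupRing (k : Type u) [Field k] (σ : PointedCone ℝ (RealSpace N)) : Type u :=
  AddMonoidAlgebra k (dualMonoid σ)

/-- The inclusion `k[S_τ] → k[S_σ]` attached to an inclusion of cones `σ ⊆ τ`. -/
def restrictHom (k : Type u) [Field k] {σ τ : PointedCone ℝ (RealSpace N)} (h : σ ≤ τ) :
    SemigroupRing k τ →ₐ[k] SemigroupRing k σ :=
  AddMonoidAlgebra.mapDomainAlgHom k k (AddSubmonoid.inclusion (dualMonoid_anti h))

/-! ### Faces give localizations -/

lemma nonneg_on_hull (s : Finset N) (u : Module.Dual ℝ (RealSpace N))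
    (hu : ∀ n ∈ s, 0 ≤ u (1 ⊗ₜ n)) :
    ∀ v ∈ PointedCone.hull ℝ ((fun n : N => (1 : ℝ) ⊗ₜ[ℤ] n) '' (s : Set N)), 0 ≤ u v := by
  intro v hv
  induction hv using Submodule.span_induction with
  | mem x hx => obtain ⟨n, hn, rfl⟩ := hx; exact hu n hn
  | zero => simp
  | add x y _ _ hx hy => rw [map_add]; exact add_nonneg hx hy
  | smul a x _ hx =>
    change 0 ≤ u ((a : ℝ) • x)
    rw [map_smul, smul_eq_mul]
    exact mul_nonneg a.2 hx

/-- Given finitely many lattice vectors, a real linear functional may be replaced by an integral one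
which vanishes, resp. is positive, on those of the vectors where the given one is. -/
lemma exists_integral (s : Finset N) [Module.Finite ℤ N] (u : Module.Dual ℝ (RealSpace N)) :
    ∃ m : Module.Dual ℤ N, ∀ n ∈ s, (u (1 ⊗ₜ n) = 0 → m n = 0) ∧ (0 < u (1 ⊗ₜ n) → 1 ≤ m n) := by
  classical
  let f : N →ₗ[ℤ] ℝ := (u.restrictScalars ℤ).comp (TensorProduct.mk ℤ ℝ N 1)
  have hf : ∀ n, f n = u (1 ⊗ₜ n) := fun n => rfl
  let G := LinearMap.range f
  have : Module.Finite ℤ G := inferInstance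
  have : Module.Free ℤ G := inferInstance
  let b := Module.Free.chooseBasis ℤ G
  let J := Module.Free.ChooseBasisIndex ℤ G
  let p : N → (J → ℝ) → ℝ := fun n x => ∑ j, (b.repr (f.rangeRestrict n) j : ℝ) * x j
  have hp0 : ∀ n, p n (fun j => (b j : ℝ)) = f n := by
    intro n
    have h := congrArg (Submodule.subtype G) (b.sum_repr (f.rangeRestrict n))
    rw [map_sum] at h
    refine Eq.trans (Finset.sum_congr rfl fun j _ => ?_) h
    rw [map_smul, zsmul_eq_mul]
    rfl
  let U : Set (J → ℝ) := ⋂ n ∈ s.filter (fun n => 0 < f n), {x | 0 < p n x}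
  have hU : IsOpen U := by
    refine isOpen_biInter_finset fun n _ => isOpen_lt continuous_const ?_
    fun_prop
  have hne : U.Nonempty := ⟨fun j => (b j : ℝ), by
    simp only [U, Set.mem_iInter]
    intro n hn
    rw [Set.mem_ofPred_eq, hp0]
    exact (Finset.mem_filter.1 hn).2⟩
  have hd : DenseRange (Pi.map (fun (_ : J) (q : ℚ) => (q : ℝ))) :=
    DenseRange.piMap fun _ => Rat.denseRange_cast
  obtain ⟨q, hq⟩ := hd.exists_mem_open hU hne
  obtain ⟨⟨d, hd0⟩, hd⟩ := IsLocalization.exist_integer_multiples_of_finite (nonZeroDivisors ℤ) q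
  have hdne : d ≠ 0 := nonZeroDivisors.ne_zero hd0
  choose z hz using hd
  have hz' : ∀ j, (z j : ℝ) = d * q j := by
    intro j
    have := hz j
    simp only [Algebra.smul_def] at this
    have h2 : ((z j : ℤ) : ℚ) = (d : ℚ) * q j := by simpa using this
    exact_mod_cast congrArg (fun x : ℚ => (x : ℝ)) h2
  let φ : G →ₗ[ℤ] ℤ := b.constr ℤ (fun j => d * z j)
  have hφ : ∀ n, ((φ (f.rangeRestrict n) : ℤ) : ℝ)
      = (d : ℝ) ^ 2 * p n (Pi.map (fun (_ : J) (q : ℚ) => (q : ℝ)) q) := by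
    intro n
    simp only [φ, Module.Basis.constr_apply_fintype, p, Finset.mul_sum, Pi.map]
    push_cast
    refine Finset.sum_congr rfl fun j _ => ?_
    simp only [Module.Basis.equivFun_apply, smul_eq_mul]
    push_cast
    rw [hz']
    ring
  refine ⟨φ.comp f.rangeRestrict, fun n hn => ⟨fun h => ?_, fun h => ?_⟩⟩
  · have : f.rangeRestrict n = 0 := Subtype.ext h
    rw [LinearMap.comp_apply, this, map_zero]
  · have h1 : 0 < p n (Pi.map (fun (_ : J) (q : ℚ) => (q : ℝ)) q) := by
      simp only [U, Set.mem_iInter] at hq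
      exact hq n (Finset.mem_filter.2 ⟨hn, h⟩)
    have h2 : (0 : ℝ) < (φ (f.rangeRestrict n) : ℤ) := by
      rw [hφ]; positivity
    have : 0 < φ (f.rangeRestrict n) := by exact_mod_cast h2
    exact this

/-- If `u` and `u'` are nonnegative on the generators, and `u'` vanishes on the generators on which
`u` does, then `u'` vanishes on the vectors of the cone on which `u` does. -/
lemma eq_zero_on_hull (s : Finset N) (u u' : Module.Dual ℝ (RealSpace N))
    (hu : ∀ n ∈ s, 0 ≤ u (1 ⊗ₜ n)) (hu' : ∀ n ∈ s, 0 ≤ u' (1 ⊗ₜ n))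
    (h : ∀ n ∈ s, u (1 ⊗ₜ n) = 0 → u' (1 ⊗ₜ n) = 0) (v : RealSpace N)
    (hv : v ∈ PointedCone.hull ℝ ((fun n : N => (1 : ℝ) ⊗ₜ[ℤ] n) '' (s : Set N)))
    (hv0 : u v = 0) : u' v = 0 := by
  classical
  obtain ⟨C, hC⟩ : ∃ C : ℝ, ∀ n ∈ s, u' (1 ⊗ₜ n) ≤ C * u (1 ⊗ₜ n) := by
    have key : ∀ n ∈ s, ∃ C : ℝ, ∀ C' ≥ C, u' (1 ⊗ₜ n) ≤ C' * u (1 ⊗ₜ n) := fun n hn => by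
      rcases (hu n hn).eq_or_lt with h0 | h0
      · exact ⟨0, fun C' _ => by rw [h n hn h0.symm, ← h0, mul_zero]⟩
      · exact ⟨u' (1 ⊗ₜ n) / u (1 ⊗ₜ n), fun C' hC' => (div_le_iff₀ h0).1 hC'⟩
    choose! C hC using key
    obtain ⟨B, hB⟩ := (s.image C).bddAbove
    exact ⟨B, fun n hn => hC n hn B (hB (by simpa using ⟨n, hn, rfl⟩))⟩
  have h1 := nonneg_on_hull s (C • u - u') (fun n hn => by simpa using hC n hn) v hv
  have h2 := nonneg_on_hull s u' hu' v hv
  rw [LinearMap.sub_apply, LinearMap.smul_apply, hv0, smul_zero, zero_sub] at h1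
  linarith

/-- A face of a rational cone `σ` is cut out by an element of `S_σ`. -/
lemma IsFace.exists_character [Module.Finite ℤ N] {σ τ : PointedCone ℝ (RealSpace N)}
    (hσ : IsRational σ) (h : IsFace τ σ) :
    ∃ m ∈ dualMonoid σ, ∀ v, v ∈ τ ↔ v ∈ σ ∧ m.baseChange ℝ v = 0 := by
  obtain ⟨s, rfl⟩ := hσ
  obtain ⟨u, hu, hτ⟩ := h
  have hs : ∀ n ∈ s, (1 : ℝ) ⊗ₜ[ℤ] n ∈
      PointedCone.hull ℝ ((fun n : N => (1 : ℝ) ⊗ₜ[ℤ] n) '' (s : Set N)) :=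
    fun n hn => Submodule.subset_span ⟨n, hn, rfl⟩
  obtain ⟨m, hm⟩ := exists_integral s u
  have hmn : ∀ n, m.baseChange ℝ (1 ⊗ₜ n) = (m n : ℝ) := fun n => by
    rw [Module.Dual.baseChange_apply_tmul, zsmul_eq_mul, mul_one]
  have hu0 : ∀ n ∈ s, 0 ≤ u (1 ⊗ₜ n) := fun n hn => hu _ (hs n hn)
  have hm0 : ∀ n ∈ s, 0 ≤ m.baseChange ℝ (1 ⊗ₜ n) := fun n hn => by
    rw [hmn]
    rcases (hu0 n hn).eq_or_lt with h | h
    · simp [(hm n hn).1 h.symm]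
    · exact_mod_cast zero_le_one.trans ((hm n hn).2 h)
  refine ⟨m, nonneg_on_hull s _ hm0, fun v => (hτ v).trans (and_congr_right fun hv => ⟨?_, ?_⟩)⟩
  · refine eq_zero_on_hull s u _ hu0 hm0 (fun n hn h => ?_) v hv
    rw [hmn, (hm n hn).1 h, Int.cast_zero]
  · refine eq_zero_on_hull s _ u hm0 hu0 (fun n hn h => ?_) v hv
    by_contra hne
    have := (hm n hn).2 ((hu0 n hn).lt_of_ne' hne)
    rw [hmn, Int.cast_eq_zero] at h
    omega

/-- If the face `τ` of the rational cone `σ` is cut out by `m ∈ S_σ`, then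
`S_τ = S_σ + ℕ (-m)`. -/
lemma exists_add_nsmul_mem {σ τ : PointedCone ℝ (RealSpace N)} (hσ : IsRational σ)
    {m : Module.Dual ℤ N} (hm : m ∈ dualMonoid σ)
    (hτ : ∀ v, v ∈ τ ↔ v ∈ σ ∧ m.baseChange ℝ v = 0) :
    ∀ w ∈ dualMonoid τ, ∃ K : ℕ, w + K • m ∈ dualMonoid σ := by
  classical
  intro w hw
  obtain ⟨s, rfl⟩ := hσ
  have hs : ∀ n ∈ s, (1 : ℝ) ⊗ₜ[ℤ] n ∈
      PointedCone.hull ℝ ((fun n : N => (1 : ℝ) ⊗ₜ[ℤ] n) '' (s : Set N)) :=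
    fun n hn => Submodule.subset_span ⟨n, hn, rfl⟩
  have hmn : ∀ (m : Module.Dual ℤ N) n, m.baseChange ℝ (1 ⊗ₜ n) = (m n : ℝ) := fun m n => by
    rw [Module.Dual.baseChange_apply_tmul, zsmul_eq_mul, mul_one]
  obtain ⟨K, hK⟩ : ∃ K : ℕ, ∀ n ∈ s, 0 ≤ w n + K * m n := by
    have key : ∀ n ∈ s, ∃ K : ℕ, ∀ K' ≥ K, 0 ≤ w n + (K' : ℤ) * m n := fun n hn => by
      have h0 := hm _ (hs n hn)
      rw [hmn, Int.cast_nonneg_iff] at h0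
      rcases h0.eq_or_lt with h | h
      · refine ⟨0, fun K' _ => ?_⟩
        have := hw _ ((hτ _).2 ⟨hs n hn, by rw [hmn, ← h, Int.cast_zero]⟩)
        rw [hmn, Int.cast_nonneg_iff] at this
        rwa [← h, mul_zero, add_zero]
      · refine ⟨(w n).natAbs, fun K' hK' => ?_⟩
        have h2 : ((w n).natAbs : ℤ) ≤ K' := by exact_mod_cast hK'
        have h3 : -(w n) ≤ ((w n).natAbs : ℤ) := by omega
        nlinarith
    choose! K hK using key
    obtain ⟨B, hB⟩ := (s.image K).bddAbove
    exact ⟨B, fun n hn => hK n hn B (hB (by simpa using ⟨n, hn, rfl⟩))⟩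
  refine ⟨K, nonneg_on_hull s _ fun n hn => ?_⟩
  rw [hmn, Int.cast_nonneg_iff]
  simpa using hK n hn

/-- If the face `τ` of the rational cone `σ` is cut out by `m ∈ S_σ`, then `k[S_τ]` is the
localization of `k[S_σ]` at the monomial `χ^m`. -/
lemma isLocalization_restrictHom (k : Type u) [Field k] {σ τ : PointedCone ℝ (RealSpace N)}
    (hσ : IsRational σ) (h : τ ≤ σ) (m : Module.Dual ℤ N) (hm : m ∈ dualMonoid σ)
    (hτ : ∀ v, v ∈ τ ↔ v ∈ σ ∧ m.baseChange ℝ v = 0) :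
    letI := (restrictHom k h).toRingHom.toAlgebra
    IsLocalization.Away (AddMonoidAlgebra.single (⟨m, hm⟩ : dualMonoid σ) (1 : k))
      (SemigroupRing k τ) := by
  have hm' : -m ∈ dualMonoid τ := fun v hv => by
    rw [map_neg, LinearMap.neg_apply, ((hτ v).1 hv).2, neg_zero]
  have H := exists_add_nsmul_mem hσ hm hτ
  let := (restrictHom k h).toRingHom.toAlgebra
  have halg : ∀ a, algebraMap (SemigroupRing k σ) (SemigroupRing k τ) a = restrictHom k h a :=
    fun _ => rfl
  have hsingle : ∀ (a : dualMonoid σ) (c : k), restrictHom k h (AddMonoidAlgebra.single a c) =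
      AddMonoidAlgebra.single (AddSubmonoid.inclusion (dualMonoid_anti h) a) c := by
    intro a c
    simp [restrictHom]
  have hinj : Function.Injective (restrictHom k h) :=
    AddMonoidAlgebra.mapDomain_injective (AddSubmonoid.inclusion_injective (dualMonoid_anti h))
  have hpow : ∀ K : ℕ, (AddMonoidAlgebra.single (⟨m, hm⟩ : dualMonoid σ) (1 : k)) ^ K =
      AddMonoidAlgebra.single (K • (⟨m, hm⟩ : dualMonoid σ)) (1 : k) := by
    intro K
    rw [AddMonoidAlgebra.single_pow, one_pow]
  refine IsLocalization.Away.mk _ ?_ ?_ ?_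
  · rw [halg, hsingle]
    refine IsUnit.of_mul_eq_one (AddMonoidAlgebra.single (⟨-m, hm'⟩ : dualMonoid τ) (1 : k)) ?_
    rw [AddMonoidAlgebra.single_mul_single, AddMonoidAlgebra.one_def, one_mul]
    congr 1
    exact Subtype.ext (add_neg_cancel m)
  · intro f
    induction f using AddMonoidAlgebra.induction_linear with
    | zero => exact ⟨0, 0, by simp⟩
    | add f g hf hg =>
      obtain ⟨K, a, ha⟩ := hf
      obtain ⟨L, b, hb⟩ := hg
      refine ⟨K + L, AddMonoidAlgebra.single ⟨m, hm⟩ (1 : k) ^ L * a +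
        AddMonoidAlgebra.single ⟨m, hm⟩ (1 : k) ^ K * b, ?_⟩
      rw [map_add, map_mul, map_mul, ← ha, ← hb, map_pow, map_pow]
      ring
    | single w c =>
      obtain ⟨K, hK⟩ := H w.1 w.2
      refine ⟨K, AddMonoidAlgebra.single ⟨_, hK⟩ c, ?_⟩
      rw [← map_pow, halg, halg, hpow, hsingle, hsingle, AddMonoidAlgebra.single_mul_single,
        mul_one]
      congr 1
  · intro a b hab
    exact ⟨0, by rw [hinj hab]⟩

end Semigroup

/-! ### The toric variety of a fan -/

section ToricVariety

variable (k : Type u) [Field k] {N : Type u} [AddCommGroup N] (Δ : Fan N)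

/-- The diagram of affine varieties `U_σ = Spec k[S_σ]`, `σ ∈ Δ`, with a morphism `U_τ ⟶ U_σ` for
`τ ⊆ σ`. -/
def Fan.diagram : Δ.cones ⥤ Scheme.{u} where
  obj σ := Spec (.of (SemigroupRing k σ.1))
  map {τ σ} f := Spec.map (CommRingCat.ofHom (restrictHom k (show τ.1 ≤ σ.1 from leOfHom f)).toRingHom)
  map_id σ := by
    have : (restrictHom k (le_refl σ.1)).toRingHom = RingHom.id _ := by
      ext <;> simp [restrictHom]
      rfl
    rw [this]
    exact Spec.map_id _
  map_comp {ρ τ σ} f g := by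
    rw [← Spec.map_comp, ← CommRingCat.ofHom_comp]
    congr 2
    ext <;> simp [restrictHom]
    rfl

/-- The zero cone belongs to every fan. -/
lemma Fan.bot_mem : ⊥ ∈ Δ.cones := by
  obtain ⟨σ, hσ⟩ := Δ.nonempty
  obtain ⟨s, hs⟩ := Δ.polyhedral σ hσ
  refine Δ.face_mem σ hσ _ ⟨∑ u ∈ s, u, fun v hv => ?_, fun v => ⟨?_, ?_⟩⟩
  · rw [LinearMap.sum_apply]
    exact Finset.sum_nonneg ((hs v).1 hv)
  · intro hv
    rw [(Submodule.mem_bot _).1 hv]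
    exact ⟨zero_mem _, map_zero _⟩
  · rintro ⟨hv, h0⟩
    rw [LinearMap.sum_apply, Finset.sum_eq_zero_iff_of_nonneg ((hs v).1 hv)] at h0
    refine (Submodule.mem_bot _).2 (Δ.stronglyConvex σ hσ v hv ((hs _).2 fun u hu => ?_))
    rw [map_neg, h0 u hu, neg_zero]

lemma Fan.isFace_of_le {σ τ : Δ.cones} (h : τ ≤ σ) : IsFace τ.1 σ.1 := by
  have := (Δ.inter_face σ.1 σ.2 τ.1 τ.2).1
  rwa [inf_eq_right.2 (show τ.1 ≤ σ.1 from h)] at this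

/-- The image of `U_τ ⟶ U_σ` is the principal open subset defined by any `m ∈ S_σ` which cuts out
the face `τ`. -/
lemma Fan.range_diagram_map {σ τ : Δ.cones} (f : τ ⟶ σ) (m : Module.Dual ℤ N)
    (hm : m ∈ dualMonoid σ.1) (hτ : ∀ v, v ∈ τ.1 ↔ v ∈ σ.1 ∧ m.baseChange ℝ v = 0) :
    Set.range ((Δ.diagram k).map f) = (PrimeSpectrum.basicOpen
      (AddMonoidAlgebra.single (⟨m, hm⟩ : dualMonoid σ.1) (1 : k)) : Set (PrimeSpectrum _)) := by
  let := (restrictHom k (show τ.1 ≤ σ.1 from leOfHom f)).toRingHom.toAlgebra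
  have := isLocalization_restrictHom k (Δ.rational σ.1 σ.2) (leOfHom f) m hm hτ
  exact PrimeSpectrum.localization_away_comap_range (SemigroupRing k τ.1) _

variable [Module.Finite ℤ N]

/-- The morphisms `U_τ ⟶ U_σ` are open embeddings. -/
instance Fan.isOpenImmersion_diagram_map {τ σ : Δ.cones} (f : τ ⟶ σ) :
    IsOpenImmersion ((Δ.diagram k).map f) := by
  obtain ⟨m, hm, hτ⟩ := IsFace.exists_character (Δ.rational σ.1 σ.2) (Δ.isFace_of_le (leOfHom f))
  let := (restrictHom k (show τ.1 ≤ σ.1 from leOfHom f)).toRingHom.toAlgebra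
  have := isLocalization_restrictHom k (Δ.rational σ.1 σ.2) (leOfHom f) m hm hτ
  exact IsOpenImmersion.of_isLocalization
    (AddMonoidAlgebra.single (⟨m, hm⟩ : dualMonoid σ.1) (1 : k))

/-- Inside `U_σ`, the open subsets `U_τ` and `U_ρ` intersect in `U_{τ ∩ ρ}`. -/
instance Fan.isLocallyDirected_diagram : (Δ.diagram k ⋙ Scheme.forget).IsLocallyDirected where
  cond {τ ρ σ} f g x y h := by
    have h' : (Δ.diagram k).map f x = (Δ.diagram k).map g y := h
    obtain ⟨m, hm, hτ⟩ := IsFace.exists_character (Δ.rational σ.1 σ.2) (Δ.isFace_of_le (leOfHom f))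
    obtain ⟨n, hn, hρ⟩ := IsFace.exists_character (Δ.rational σ.1 σ.2) (Δ.isFace_of_le (leOfHom g))
    let κ : Δ.cones := ⟨τ.1 ⊓ ρ.1, Δ.face_mem τ.1 τ.2 _ (Δ.inter_face τ.1 τ.2 ρ.1 ρ.2).1⟩
    let a : κ ⟶ τ := homOfLE (show τ.1 ⊓ ρ.1 ≤ τ.1 from inf_le_left)
    let b : κ ⟶ ρ := homOfLE (show τ.1 ⊓ ρ.1 ≤ ρ.1 from inf_le_right)
    have hκ : ∀ v, v ∈ κ.1 ↔ v ∈ σ.1 ∧ (m + n).baseChange ℝ v = 0 := by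
      intro v
      rw [map_add, LinearMap.add_apply, Submodule.mem_inf, hτ, hρ]
      constructor
      · rintro ⟨⟨h1, h2⟩, -, h3⟩
        exact ⟨h1, by rw [h2, h3, add_zero]⟩
      · rintro ⟨h1, h2⟩
        have := hm v h1
        have := hn v h1
        exact ⟨⟨h1, by linarith⟩, h1, by linarith⟩
    have hmem : (Δ.diagram k).map f x ∈ Set.range ((Δ.diagram k).map (a ≫ f)) := by
      rw [Δ.range_diagram_map k (a ≫ f) (m + n) (add_mem hm hn) hκ]
      have h1 : (Δ.diagram k).map f x ∈ Set.range ((Δ.diagram k).map f) := ⟨x, rfl⟩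
      have h2 : (Δ.diagram k).map f x ∈ Set.range ((Δ.diagram k).map g) := ⟨y, h'.symm⟩
      rw [Δ.range_diagram_map k f m hm hτ] at h1
      rw [Δ.range_diagram_map k g n hn hρ] at h2
      have h3 : (AddMonoidAlgebra.single (⟨m + n, add_mem hm hn⟩ : dualMonoid σ.1) (1 : k)) =
          AddMonoidAlgebra.single (⟨m, hm⟩ : dualMonoid σ.1) (1 : k) *
            AddMonoidAlgebra.single (⟨n, hn⟩ : dualMonoid σ.1) (1 : k) := by
        rw [AddMonoidAlgebra.single_mul_single, mul_one]
        rfl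
      rw [h3, PrimeSpectrum.basicOpen_mul]
      exact ⟨h1, h2⟩
    obtain ⟨z, hz⟩ := hmem
    refine ⟨κ, a, b, z, ?_, ?_⟩
    · apply ((Δ.diagram k).map f).isOpenEmbedding.injective
      rw [← hz, Functor.map_comp]
      rfl
    · apply ((Δ.diagram k).map g).isOpenEmbedding.injective
      rw [← h', ← hz, Subsingleton.elim (a ≫ f) (b ≫ g), Functor.map_comp]
      rfl

/-- The affine toric variety `U_σ = Spec k[S_σ]` over `k`. It is a monoid scheme, through Mathlib's
bialgebra structure `χ ↦ χ ⊗ χ` on the semigroup ring. -/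
abbrev affineToricVariety (σ : PointedCone ℝ (RealSpace N)) : Over (Spec (.of k)) :=
  (Spec (.of (SemigroupRing k σ))).asOver (Spec (.of k))

/-- The toric variety `X(Δ)`, as a scheme over `k`: the affine varieties `U_σ` glued along the open
subvarieties `U_{σ ∩ τ}`. -/
def Fan.toricVariety : Over (Spec (.of k)) :=
  Over.mk (Y := colimit (Δ.diagram k)) (colimit.desc (Δ.diagram k)
    { pt := Spec (.of k)
      ι :=
        { app := fun σ => (affineToricVariety k σ.1).hom
          naturality := fun τ σ f => by
            change Spec.map _ ≫ Spec.map _ = Spec.map _ ≫ 𝟙 _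
            rw [Category.comp_id, ← Spec.map_comp, ← CommRingCat.ofHom_comp]
            congr 2
            exact (restrictHom k (show τ.1 ≤ σ.1 from leOfHom f)).comp_algebraMap } })

/-- The open embedding `U_σ ⟶ X(Δ)`. -/
def Fan.ι (σ : Δ.cones) : affineToricVariety k σ.1 ⟶ Δ.toricVariety k :=
  Over.homMk (colimit.ι (Δ.diagram k) σ) (colimit.ι_desc _ _)

/-- The torus `T = U_{0} = Spec k[M]`, with its multiplication given by `χ ↦ χ ⊗ χ`. -/
abbrev torus (N : Type u) [AddCommGroup N] : Over (Spec (.of k)) :=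
  affineToricVariety k (⊥ : PointedCone ℝ (RealSpace N))

/-- The open embedding `T ⟶ X(Δ)`. -/
def Fan.torusι : torus k N ⟶ Δ.toricVariety k :=
  Δ.ι k ⟨⊥, Δ.bot_mem⟩

end ToricVariety

/-! ### Algebraic semigroups -/

section AlgebraicSemigroup

variable {k : Type u} [Field k]

/-- A structure of an algebraic semigroup on a variety `S` over `k`: an associative morphism
`S × S ⟶ S` over `k`. -/
structure AlgebraicSemigroup (S : Over (Spec (.of k))) where
  /-- The multiplication. -/
  mul : S ⊗ S ⟶ S
  mul_assoc : (mul ▷ S) ≫ mul = (α_ S S S).hom ≫ (S ◁ mul) ≫ mul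

/-- The multiplication of an algebraic semigroup `S` is compatible, along `j : T ⟶ S`, with the
multiplication on the monoid scheme `T`. -/
def AlgebraicSemigroup.IsCompatible {S T : Over (Spec (.of k))} [MonObj T]
    (s : AlgebraicSemigroup S) (j : T ⟶ S) : Prop :=
  (j ⊗ₘ j) ≫ s.mul = MonObj.mul ≫ j

/-- A structure of a toric semigroup on `X(Δ)`: a structure of an algebraic semigroup whose
multiplication is compatible with the multiplication on the torus. -/
structure ToricSemigroup (k : Type u) [Field k] {N : Type u} [AddCommGroup N] [Module.Finite ℤ N]
    (Δ : Fan N) extends AlgebraicSemigroup (Δ.toricVariety k) where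
  compatible : toAlgebraicSemigroup.IsCompatible (Δ.torusι k)

end AlgebraicSemigroup

end

end Toric

/-! It suffices that any two cones `σ`, `τ` of `Δ` lie in a common cone: a maximal cone then
contains all others, and a cone of a fan contained in another is a face of it.

To find the common cone, choose lattice vectors `n` and `n'` interior to `σ` and `τ`. Each defines a
formal curve `χ^m ↦ X^{m(n)}`, a `k[[X]]`-point of `U_σ` (resp. `U_τ`) whose generic point lies in
`T`. The product of the two curves is a `k[[X]]`-point of `X(Δ)`, which generically is the torus
point of `n + n'`, because the multiplication extends that of `T` (`specHom_toLaurent_curveMul`).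
Its closed point lies in some `U_ρ`.

The key point is that rescaling the curves to `a • n` and `b • n'` with `a, b > 0` leaves their
closed points unchanged, hence also the closed point of the product (`curveMul_closedPoint`). So one
`ρ` serves all `a, b`. As `k[[X]]` is local, each product curve factors through `U_ρ`, so `X^{a m(n)
+ b m(n')}` is a power series for every `m ∈ S_ρ`, and `a m(n) + b m(n') ≥ 0`. Letting `a` or `b`
grow gives `m(n) ≥ 0` and `m(n') ≥ 0`, so `n, n' ∈ ρ` by duality. Now `σ ∩ ρ` is a face of `σ`
containing an interior vector, so `σ ≤ ρ`; likewise `τ ≤ ρ`. -/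

namespace Toric

/-! ### Lattice vectors in cones, duality, and directed fans -/

section Cones

variable {N : Type u} [AddCommGroup N]

lemma baseChange_one_tmul (m : Module.Dual ℤ N) (n : N) :
    m.baseChange ℝ (1 ⊗ₜ n) = (m n : ℝ) := by
  rw [Module.Dual.baseChange_apply_tmul, zsmul_eq_mul, mul_one]

lemma dualMonoid_apply_nonneg {σ : PointedCone ℝ (RealSpace N)} {n : N}
    (hn : (1 : ℝ) ⊗ₜ[ℤ] n ∈ σ) {m : Module.Dual ℤ N} (hm : m ∈ dualMonoid σ) : 0 ≤ m n := by
  have := hm _ hn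
  rwa [baseChange_one_tmul, Int.cast_nonneg_iff] at this

/-- Duality: a lattice vector on which all of `S_σ` is nonnegative lies in `σ`. -/
lemma tmul_mem_of_forall_dualMonoid [Module.Finite ℤ N] {σ : PointedCone ℝ (RealSpace N)}
    (hp : IsPolyhedral σ) (hr : IsRational σ) {n : N} (hn : ∀ m ∈ dualMonoid σ, 0 ≤ m n) :
    (1 : ℝ) ⊗ₜ[ℤ] n ∈ σ := by
  classical
  obtain ⟨t, ht⟩ := hp
  obtain ⟨s, rfl⟩ := hr
  by_contra h
  rw [ht] at h
  push Not at h
  obtain ⟨u, hut, hu⟩ := h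
  -- Here `u` is nonnegative on `σ` and negative at `n`. Including `-n` among the vectors makes the
  -- integral replacement satisfy `m (-n) ≥ 1`.
  obtain ⟨m, hm⟩ := exists_integral (insert (-n) s) u
  have h1 : m ∈ dualMonoid
      (PointedCone.hull ℝ ((fun n : N => (1 : ℝ) ⊗ₜ[ℤ] n) '' (s : Set N))) := by
    refine nonneg_on_hull s _ fun x hx => ?_
    rw [baseChange_one_tmul, Int.cast_nonneg_iff]
    have hux : 0 ≤ u (1 ⊗ₜ x) := (ht _).1 (Submodule.subset_span ⟨x, hx, rfl⟩) u hut
    have hmx := hm x (Finset.mem_insert_of_mem hx)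
    rcases hux.eq_or_lt with h0 | h0
    · exact (hmx.1 h0.symm).ge
    · exact zero_le_one.trans (hmx.2 h0)
  have h2 := (hm (-n) (Finset.mem_insert_self _ _)).2 (by
    rw [TensorProduct.tmul_neg, map_neg]; linarith)
  have h3 := hn m h1
  rw [map_neg] at h2
  omega

/-- A rational cone contains a lattice vector which lies on no proper face. -/
lemma IsRational.exists_interior {σ : PointedCone ℝ (RealSpace N)} (hσ : IsRational σ) :
    ∃ n : N, (1 : ℝ) ⊗ₜ[ℤ] n ∈ σ ∧ ∀ τ, IsFace τ σ → (1 : ℝ) ⊗ₜ[ℤ] n ∈ τ → σ ≤ τ := by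
  obtain ⟨s, rfl⟩ := hσ
  have hs : ∀ n ∈ s, (1 : ℝ) ⊗ₜ[ℤ] n ∈
      PointedCone.hull ℝ ((fun n : N => (1 : ℝ) ⊗ₜ[ℤ] n) '' (s : Set N)) :=
    fun n hn => Submodule.subset_span ⟨n, hn, rfl⟩
  -- A functional nonnegative on the generators vanishes at their sum only if it vanishes at each of
  -- them.
  refine ⟨∑ n ∈ s, n, ?_, ?_⟩
  · rw [TensorProduct.tmul_sum]
    exact sum_mem hs
  · rintro τ ⟨u, hu, hτ⟩ hn
    have h0 := ((hτ _).1 hn).2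
    rw [TensorProduct.tmul_sum, map_sum,
      Finset.sum_eq_zero_iff_of_nonneg fun n hn => hu _ (hs n hn)] at h0
    refine Submodule.span_le.2 ?_
    rintro _ ⟨n, hn, rfl⟩
    exact (hτ _).2 ⟨hs n hn, h0 n hn⟩

/-- A fan in which any two cones lie in a common cone is generated by a single cone. -/
lemma Fan.exists_isGeneratedBy (Δ : Fan N)
    (h : ∀ σ ∈ Δ.cones, ∀ τ ∈ Δ.cones, ∃ ρ ∈ Δ.cones, σ ≤ ρ ∧ τ ≤ ρ) :
    ∃ σ ∈ Δ.cones, Δ.IsGeneratedBy σ := by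
  obtain ⟨σ, hσ⟩ := Δ.finite.exists_maximal Δ.nonempty
  refine ⟨σ, hσ.prop, hσ.prop, fun τ => ⟨fun hτ => .inr ?_, ?_⟩⟩
  · obtain ⟨ρ, hρ, h1, h2⟩ := h σ hσ.prop τ hτ
    have h3 : τ ≤ σ := h2.trans (hσ.le_of_ge hρ h1)
    exact Δ.isFace_of_le (σ := ⟨σ, hσ.prop⟩) (τ := ⟨τ, hτ⟩) h3
  · rintro (rfl | hτ)
    · exact hσ.prop
    · exact Δ.face_mem σ hσ.prop τ hτ

end Cones

/-! ### Affine schemes over `k` and algebra homomorphisms -/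

section SpecHom

open CartesianMonoidalCategory

variable {k : Type u} [Field k] {A B C : Type u} [CommRing A] [Algebra k A] [CommRing B]
  [Algebra k B] [CommRing C] [Algebra k C]

/-- The spectrum of a `k`-algebra as a scheme over `Spec k`. -/
noncomputable abbrev specOver (k A : Type u) [Field k] [CommRing A] [Algebra k A] :
    Over (Spec (.of k)) :=
  (Spec (.of A)).asOver (Spec (.of k))

/-- The morphism of schemes over `Spec k` attached to a homomorphism of `k`-algebras. -/
noncomputable def specHom (φ : A →ₐ[k] B) : specOver k B ⟶ specOver k A :=
  Over.homMk (Spec.map (CommRingCat.ofHom φ.toRingHom)) (by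
    change Spec.map _ ≫ Spec.map _ = Spec.map _
    rw [← Spec.map_comp, ← CommRingCat.ofHom_comp]
    congr 2
    exact φ.comp_algebraMap)

lemma specHom_comp (φ : A →ₐ[k] B) (ψ : B →ₐ[k] C) :
    specHom (ψ.comp φ) = specHom ψ ≫ specHom φ := by
  ext1
  change Spec.map _ = Spec.map _ ≫ Spec.map _
  rw [← Spec.map_comp, ← CommRingCat.ofHom_comp]
  rfl

lemma exists_specHom_eq (f : specOver k B ⟶ specOver k A) : ∃ φ : A →ₐ[k] B, specHom φ = f := by
  obtain ⟨φ, hφ⟩ := Spec.map_surjective f.left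
  have hw : Spec.map φ ≫ Spec.map (CommRingCat.ofHom (algebraMap k A)) =
      Spec.map (CommRingCat.ofHom (algebraMap k B)) := by
    rw [hφ]; exact Over.w f
  rw [← Spec.map_comp, Spec.map_inj] at hw
  refine ⟨{ φ.hom with commutes' := fun r => congr($hw r) }, ?_⟩
  ext1
  exact hφ

lemma specHom_injective : Function.Injective (specHom : (A →ₐ[k] B) → _) := by
  intro φ ψ h
  have h' : CommRingCat.ofHom φ.toRingHom = CommRingCat.ofHom ψ.toRingHom :=
    Spec.map_injective congr($(h).left)
  ext a
  exact congr($h' a)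

/-- The product of two points of the monoid scheme attached to a bialgebra. -/
lemma lift_specHom_mul {H : Type u} [CommRing H] [Bialgebra k H] (φ ψ : H →ₐ[k] B) :
    lift (specHom φ) (specHom ψ) ≫ MonObj.mul (X := specOver k H) =
      specHom ((Algebra.TensorProduct.lift φ ψ fun _ _ => .all _ _).comp
        (Bialgebra.comulAlgHom k H)) := by
  have w : Spec.map (CommRingCat.ofHom φ.toRingHom) ≫
      Spec.map (CommRingCat.ofHom (algebraMap k H)) =
      Spec.map (CommRingCat.ofHom ψ.toRingHom) ≫ Spec.map (CommRingCat.ofHom (algebraMap k H)) :=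
    (Over.w (specHom φ)).trans (Over.w (specHom ψ)).symm
  -- Under `Spec H × Spec H ≅ Spec (H ⊗ H)`, a pair of points corresponds to the homomorphism it
  -- induces on the tensor product.
  have h : pullback.lift _ _ w = Spec.map (CommRingCat.ofHom
      (Algebra.TensorProduct.lift φ ψ fun _ _ => .all _ _).toRingHom) ≫
        (pullbackSpecIso k H H).inv := by
    refine pullback.hom_ext ?_ ?_
    · rw [pullback.lift_fst, Category.assoc, pullbackSpecIso_inv_fst, ← Spec.map_comp,
        ← CommRingCat.ofHom_comp]
      congr 2
      ext x
      simp
    · rw [pullback.lift_snd, Category.assoc, pullbackSpecIso_inv_snd, ← Spec.map_comp,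
        ← CommRingCat.ofHom_comp]
      congr 2
      ext x
      simp
  ext1
  change pullback.lift _ _ w ≫ (pullbackSpecIso k H H).hom ≫
    Spec.map (CommRingCat.ofHom (Bialgebra.comulAlgHom k H).toRingHom) = Spec.map _
  rw [h, Category.assoc, Iso.inv_hom_id_assoc, ← Spec.map_comp, ← CommRingCat.ofHom_comp]
  rfl

end SpecHom

/-! ### Formal curves and Laurent points attached to lattice vectors -/

section Curves

variable {k : Type u} [Field k] {N : Type u} [AddCommGroup N]

lemma semigroupRing_algHom_ext {σ : PointedCone ℝ (RealSpace N)} {A : Type u} [CommRing A]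
    [Algebra k A] {φ ψ : SemigroupRing k σ →ₐ[k] A}
    (h : ∀ m, φ (AddMonoidAlgebra.single m 1) = ψ (AddMonoidAlgebra.single m 1)) : φ = ψ := by
  apply AddMonoidAlgebra.algHom_ext h
  exact Subsingleton.elim _ _

/-- The formal curve in `U_σ` attached to a lattice vector `n ∈ σ`: the point with coordinates
`χ^m ↦ X^{m(n)}`. -/
noncomputable def formalCurve (k : Type u) [Field k] {σ : PointedCone ℝ (RealSpace N)} {n : N}
    (hn : (1 : ℝ) ⊗ₜ[ℤ] n ∈ σ) : SemigroupRing k σ →ₐ[k] PowerSeries k :=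
  AddMonoidAlgebra.lift k _ _
    { toFun := fun m => PowerSeries.X ^ (m.toAdd.1 n).toNat
      map_one' := by simp
      map_mul' := fun m m' => by
        rw [← pow_add]
        congr 1
        exact Int.toNat_add (dualMonoid_apply_nonneg hn m.toAdd.2)
          (dualMonoid_apply_nonneg hn m'.toAdd.2) }

lemma formalCurve_single {σ : PointedCone ℝ (RealSpace N)} {n : N}
    (hn : (1 : ℝ) ⊗ₜ[ℤ] n ∈ σ) (m : dualMonoid σ) :
    formalCurve k hn (AddMonoidAlgebra.single m 1) = PowerSeries.X ^ (m.1 n).toNat := by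
  simp [formalCurve]

/-- The field of Laurent series, as the field of fractions of the ring of power series. -/
abbrev LaurentField (k : Type u) [Field k] : Type u := FractionRing (PowerSeries k)

lemma algebraMap_X_ne_zero : algebraMap (PowerSeries k) (LaurentField k) PowerSeries.X ≠ 0 := by
  rw [map_ne_zero_iff _ (IsFractionRing.injective _ _)]
  exact PowerSeries.X_ne_zero

/-- The Laurent series point of the torus attached to a lattice vector `n`, with coordinates
`χ^m ↦ X^{m(n)}`. -/
noncomputable def laurentCurve (k : Type u) [Field k] (n : N) :
    SemigroupRing k (⊥ : PointedCone ℝ (RealSpace N)) →ₐ[k] LaurentField k :=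
  AddMonoidAlgebra.lift k _ _
    { toFun := fun m => algebraMap (PowerSeries k) (LaurentField k) PowerSeries.X ^ (m.toAdd.1 n)
      map_one' := by simp
      map_mul' := fun m m' => by
        rw [← zpow_add₀ algebraMap_X_ne_zero]
        rfl }

lemma laurentCurve_single (n : N) (m : dualMonoid (⊥ : PointedCone ℝ (RealSpace N))) :
    laurentCurve k n (AddMonoidAlgebra.single m 1) =
      algebraMap (PowerSeries k) (LaurentField k) PowerSeries.X ^ (m.1 n) := by
  simp [laurentCurve]

lemma restrictHom_single {σ τ : PointedCone ℝ (RealSpace N)} (h : σ ≤ τ) (m : dualMonoid τ) :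
    restrictHom k h (AddMonoidAlgebra.single m 1) =
      AddMonoidAlgebra.single (AddSubmonoid.inclusion (dualMonoid_anti h) m) 1 := by
  simp [restrictHom]

/-- The inclusion of power series into Laurent series. -/
noncomputable abbrev toLaurent (k : Type u) [Field k] : PowerSeries k →ₐ[k] LaurentField k :=
  IsScalarTower.toAlgHom k (PowerSeries k) (LaurentField k)

/-- The generic point of a formal curve lies in the torus, where the group law is known. -/
lemma toLaurent_comp_formalCurve {σ : PointedCone ℝ (RealSpace N)} {n : N}
    (hn : (1 : ℝ) ⊗ₜ[ℤ] n ∈ σ) :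
    (toLaurent k).comp (formalCurve k hn) = (laurentCurve k n).comp (restrictHom k bot_le) := by
  refine semigroupRing_algHom_ext fun m => ?_
  rw [AlgHom.comp_apply, AlgHom.comp_apply, formalCurve_single, restrictHom_single,
    laurentCurve_single, map_pow, ← zpow_natCast,
    Int.toNat_of_nonneg (dualMonoid_apply_nonneg hn m.2)]
  rfl

/-- A negative power of `X` is not a power series, since `X` is not a unit of `k[[X]]`. -/
lemma nonneg_of_toLaurent_eq_zpow {f : PowerSeries k} {a : ℤ}
    (h : toLaurent k f = algebraMap (PowerSeries k) (LaurentField k) PowerSeries.X ^ a) :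
    0 ≤ a := by
  by_contra! ha
  obtain ⟨j, rfl⟩ := Int.eq_negSucc_of_lt_zero ha
  have h1 : algebraMap (PowerSeries k) (LaurentField k) (f * PowerSeries.X ^ (j + 1)) =
      algebraMap _ _ 1 := by
    rw [map_mul, map_one, map_pow]
    rw [zpow_negSucc] at h
    exact (congrArg (· * _) h).trans (inv_mul_cancel₀ (pow_ne_zero _ algebraMap_X_ne_zero))
  have h2 := congrArg PowerSeries.constantCoeff (IsFractionRing.injective _ _ h1)
  simp at h2

/-- The constant coefficient of a power series. -/
noncomputable def constantCoeffAlgHom (k : Type u) [Field k] : PowerSeries k →ₐ[k] k :=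
  { PowerSeries.constantCoeff (R := k) with
    commutes' := fun r => by
      change PowerSeries.constantCoeff (algebraMap k (PowerSeries k) r) = r
      simp }

/-- The closed point of a formal curve does not change when its direction is rescaled. -/
lemma constantCoeff_comp_formalCurve {σ : PointedCone ℝ (RealSpace N)} {n n' : N}
    (hn : (1 : ℝ) ⊗ₜ[ℤ] n ∈ σ) (hn' : (1 : ℝ) ⊗ₜ[ℤ] n' ∈ σ) {a : ℕ} (ha : a ≠ 0)
    (h : n' = a • n) :
    (constantCoeffAlgHom k).comp (formalCurve k hn') =
      (constantCoeffAlgHom k).comp (formalCurve k hn) := by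
  refine semigroupRing_algHom_ext fun m => ?_
  rw [AlgHom.comp_apply, AlgHom.comp_apply, formalCurve_single, formalCurve_single, map_pow,
    map_pow]
  have h0 : constantCoeffAlgHom k PowerSeries.X = 0 := PowerSeries.constantCoeff_X
  have h1 := dualMonoid_apply_nonneg hn m.2
  have h2 : m.1 n' = a * m.1 n := by rw [h, map_nsmul, nsmul_eq_mul]
  -- At `X = 0` the coordinate `χ^m` becomes 1 or 0 according to whether its exponent vanishes, and
  -- a nonzero factor `a` does not affect this.
  rw [h0, zero_pow_eq, zero_pow_eq]
  congr 1
  rw [h2, eq_iff_iff, Int.toNat_eq_zero, Int.toNat_eq_zero, (mul_nonneg (by simp) h1).ge_iff_eq',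
    h1.ge_iff_eq']
  simp [ha]

/-- Since `χ^m ↦ χ^m ⊗ χ^m`, coordinates multiply and the exponents `m(n)` and `m(n')` add. -/
lemma lift_laurentCurve_comul (n n' : N) :
    (Algebra.TensorProduct.lift (laurentCurve k n) (laurentCurve k n') fun _ _ => .all _ _).comp
        (Bialgebra.comulAlgHom k _) = laurentCurve k (n + n') := by
  refine semigroupRing_algHom_ext fun m => ?_
  have h := zpow_add₀ (algebraMap_X_ne_zero (k := k)) (m.1 n) (m.1 n')
  simpa [laurentCurve_single] using h.symm

end Curves

/-! ### Charts of the toric variety -/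

section Semigroup

open CartesianMonoidalCategory

variable {k : Type u} [Field k] {N : Type u} [AddCommGroup N] [Module.Finite ℤ N] {Δ : Fan N}

lemma Fan.specHom_restrictHom_ι (σ τ : Δ.cones) (h : τ.1 ≤ σ.1) :
    specHom (restrictHom k h) ≫ Δ.ι k σ = Δ.ι k τ := by
  ext1
  exact colimit.w (Δ.diagram k) (homOfLE h : τ ⟶ σ)

instance Fan.isOpenImmersion_ι (σ : Δ.cones) : IsOpenImmersion (Δ.ι k σ).left :=
  inferInstanceAs (IsOpenImmersion (colimit.ι (Δ.diagram k) σ))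

lemma Fan.exists_mem_range_ι (x : (Δ.toricVariety k).left) :
    ∃ σ : Δ.cones, x ∈ Set.range (Δ.ι k σ).left := by
  obtain ⟨σ, y, hy⟩ := Scheme.IsLocallyDirected.ι_jointly_surjective (Δ.diagram k) x
  exact ⟨σ, y, hy⟩

/-- A morphism from the spectrum of a local ring which sends the closed point into `U_σ` factors
through `U_σ`. -/
lemma Fan.exists_specHom_comp_ι_eq {R : Type u} [CommRing R] [IsLocalRing R] [Algebra k R]
    (f : specOver k R ⟶ Δ.toricVariety k) (σ : Δ.cones)
    (h : f.left (IsLocalRing.closedPoint R) ∈ Set.range (Δ.ι k σ).left) :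
    ∃ φ : SemigroupRing k σ.1 →ₐ[k] R, specHom φ ≫ Δ.ι k σ = f := by
  have hr : Set.range f.left ⊆ Set.range (Δ.ι k σ).left := by
    -- An open subset of the spectrum of a local ring containing the closed point is everything.
    have := IsLocalRing.closed_point_mem_iff.1
      (show IsLocalRing.closedPoint R ∈ f.left ⁻¹ᵁ (Δ.ι k σ).left.opensRange from h)
    rintro _ ⟨x, rfl⟩
    exact (this ▸ trivial : x ∈ f.left ⁻¹ᵁ (Δ.ι k σ).left.opensRange)
  let g : specOver k R ⟶ affineToricVariety k σ.1 :=
    Over.homMk (IsOpenImmersion.lift (Δ.ι k σ).left f.left hr) (by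
      rw [← Over.w (Δ.ι k σ), IsOpenImmersion.lift_fac_assoc, Over.w f])
  obtain ⟨φ, hφ⟩ := exists_specHom_eq g
  refine ⟨φ, ?_⟩
  rw [hφ]
  ext1
  exact IsOpenImmersion.lift_fac _ _ _

instance Fan.mono_ι (σ : Δ.cones) : Mono (Δ.ι k σ) :=
  (Over.forget _).mono_of_mono_map (inferInstanceAs (Mono (Δ.ι k σ).left))

/-! ### Products of formal curves in a toric semigroup -/

namespace ToricSemigroup

variable (s : ToricSemigroup k Δ) {σ τ : Δ.cones}

/-- The product, in the toric semigroup, of two formal curves. -/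
noncomputable def curveMul {n n' : N} (hn : (1 : ℝ) ⊗ₜ[ℤ] n ∈ σ.1)
    (hn' : (1 : ℝ) ⊗ₜ[ℤ] n' ∈ τ.1) : specOver k (PowerSeries k) ⟶ Δ.toricVariety k :=
  lift (specHom (formalCurve k hn) ≫ Δ.ι k σ) (specHom (formalCurve k hn') ≫ Δ.ι k τ) ≫ s.mul

/-- Both factors are generically torus points, so compatibility reduces their product to the one in
`T`. -/
lemma specHom_toLaurent_curveMul {n n' : N} (hn : (1 : ℝ) ⊗ₜ[ℤ] n ∈ σ.1)
    (hn' : (1 : ℝ) ⊗ₜ[ℤ] n' ∈ τ.1) :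
    specHom (toLaurent k) ≫ s.curveMul hn hn' =
      specHom (laurentCurve k (n + n')) ≫ Δ.torusι k := by
  have key : ∀ {σ : Δ.cones} {n : N} (hn : (1 : ℝ) ⊗ₜ[ℤ] n ∈ σ.1),
      specHom (toLaurent k) ≫ specHom (formalCurve k hn) ≫ Δ.ι k σ =
        specHom (laurentCurve k n) ≫ Δ.torusι k := by
    intro σ n hn
    rw [← Category.assoc, ← specHom_comp, toLaurent_comp_formalCurve, specHom_comp,
      Category.assoc]
    congr 1
    exact Fan.specHom_restrictHom_ι σ ⟨⊥, Δ.bot_mem⟩ bot_le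
  rw [curveMul, ← Category.assoc, comp_lift, key, key, ← lift_map, Category.assoc]
  have hc : (Δ.torusι k ⊗ₘ Δ.torusι k) ≫ s.mul = MonObj.mul ≫ Δ.torusι k := s.compatible
  rw [hc, ← Category.assoc]
  erw [lift_specHom_mul]
  rw [lift_laurentCurve_comul]

/-- The product at the closed point depends only on the factors at `X = 0`, which rescaling does not
move. -/
lemma curveMul_closedPoint {n n₁ n' n₁' : N} (hn : (1 : ℝ) ⊗ₜ[ℤ] n ∈ σ.1)
    (hn₁ : (1 : ℝ) ⊗ₜ[ℤ] n₁ ∈ σ.1) (hn' : (1 : ℝ) ⊗ₜ[ℤ] n' ∈ τ.1)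
    (hn₁' : (1 : ℝ) ⊗ₜ[ℤ] n₁' ∈ τ.1) {a b : ℕ} (ha : a ≠ 0) (hb : b ≠ 0) (h : n₁ = a • n)
    (h' : n₁' = b • n') :
    (s.curveMul hn₁ hn₁').left (IsLocalRing.closedPoint _) =
      (s.curveMul hn hn').left (IsLocalRing.closedPoint _) := by
  have hcomp : specHom (constantCoeffAlgHom k) ≫ s.curveMul hn₁ hn₁' =
      specHom (constantCoeffAlgHom k) ≫ s.curveMul hn hn' := by
    simp only [curveMul, ← Category.assoc, comp_lift]
    simp only [← specHom_comp, constantCoeff_comp_formalCurve hn hn₁ ha h,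
      constantCoeff_comp_formalCurve hn' hn₁' hb h']
  have hpt : (specHom (constantCoeffAlgHom k)).left (IsLocalRing.closedPoint k) =
      IsLocalRing.closedPoint (PowerSeries k) := by
    have : IsLocalHom (constantCoeffAlgHom k).toRingHom :=
      ⟨fun f hf => PowerSeries.isUnit_iff_constantCoeff.2 hf⟩
    exact IsLocalRing.comap_closedPoint (constantCoeffAlgHom k).toRingHom
  have hpt' := congrArg (fun f => f.left (IsLocalRing.closedPoint k)) hcomp
  exact (congrArg (s.curveMul hn₁ hn₁').left hpt).symm.trans
    (hpt'.trans (congrArg (s.curveMul hn hn').left hpt))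

/-- If `X(Δ)` is a toric semigroup, any two cones of `Δ` lie in a common cone of `Δ`. -/
lemma exists_le_le (s : ToricSemigroup k Δ) (σ τ : Δ.cones) :
    ∃ ρ : Δ.cones, σ.1 ≤ ρ.1 ∧ τ.1 ≤ ρ.1 := by
  obtain ⟨n, hn, hσ⟩ := (Δ.rational σ.1 σ.2).exists_interior
  obtain ⟨n', hn', hτ⟩ := (Δ.rational τ.1 τ.2).exists_interior
  have hsmul : ∀ {σ : PointedCone ℝ (RealSpace N)} {n : N}, (1 : ℝ) ⊗ₜ[ℤ] n ∈ σ → ∀ a : ℕ,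
      (1 : ℝ) ⊗ₜ[ℤ] (a • n) ∈ σ := fun hn a => by
    rw [TensorProduct.tmul_smul]
    exact nsmul_mem hn a
  -- `ρ` is fixed before any multiples `a`, `b` are taken, so it is independent of them.
  obtain ⟨ρ, hρ⟩ := Fan.exists_mem_range_ι ((s.curveMul hn hn').left (IsLocalRing.closedPoint _))
  have key : ∀ m ∈ dualMonoid ρ.1, ∀ a b : ℕ, a ≠ 0 → b ≠ 0 → 0 ≤ a * m n + b * m n' := by
    intro m hm a b ha hb
    obtain ⟨φ, hφ⟩ := Fan.exists_specHom_comp_ι_eq (s.curveMul (hsmul hn a) (hsmul hn' b)) ρ (by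
      rw [s.curveMul_closedPoint hn _ hn' _ ha hb rfl rfl]
      exact hρ)
    have h := s.specHom_toLaurent_curveMul (hsmul hn a) (hsmul hn' b)
    -- Both sides are Laurent points of `U_ρ`; cancelling the monomorphism into `X(Δ)` turns the
    -- equality into one of homomorphisms on `k[S_ρ]`, to be evaluated at `χ^m`.
    rw [← hφ, Fan.torusι, ← Fan.specHom_restrictHom_ι ρ ⟨⊥, Δ.bot_mem⟩ bot_le, ← Category.assoc,
      ← Category.assoc, cancel_mono, ← specHom_comp, ← specHom_comp] at h
    have h1 := congr($(specHom_injective h) (AddMonoidAlgebra.single ⟨m, hm⟩ 1))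
    rw [AlgHom.comp_apply, AlgHom.comp_apply, restrictHom_single, laurentCurve_single] at h1
    simpa using nonneg_of_toLaurent_eq_zpow h1
  have hmem : ∀ {n n' : N}, (∀ m ∈ dualMonoid ρ.1, ∀ a : ℕ, a ≠ 0 → 0 ≤ a * m n + m n') →
      (1 : ℝ) ⊗ₜ[ℤ] n ∈ ρ.1 := by
    intro n n' h
    refine tmul_mem_of_forall_dualMonoid (Δ.polyhedral _ ρ.2) (Δ.rational _ ρ.2) fun m hm => ?_
    by_contra! hlt
    -- If `m n ≤ -1`, the multiple `a = |m n'| + 1` makes `a * m n + m n'` negative.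
    have := h m hm ((m n').natAbs + 1) (by simp)
    push_cast at this
    have h2 := le_abs_self (m n')
    nlinarith [abs_nonneg (m n')]
  have hnρ : (1 : ℝ) ⊗ₜ[ℤ] n ∈ ρ.1 :=
    hmem fun m hm a ha => by simpa using key m hm a 1 ha one_ne_zero
  have hnρ' : (1 : ℝ) ⊗ₜ[ℤ] n' ∈ ρ.1 :=
    hmem fun m hm a ha => by simpa [add_comm] using key m hm 1 a one_ne_zero ha
  exact ⟨ρ, (hσ _ (Δ.inter_face _ σ.2 _ ρ.2).1 ⟨hn, hnρ⟩).trans inf_le_right,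
    (hτ _ (Δ.inter_face _ τ.2 _ ρ.2).1 ⟨hn', hnρ'⟩).trans inf_le_right⟩

end ToricSemigroup

/-- The toric variety of a fan generated by a single cone is affine. -/
lemma Fan.IsGeneratedBy.isAffine {σ : PointedCone ℝ (RealSpace N)} (h : Δ.IsGeneratedBy σ) :
    IsAffine (Δ.toricVariety k).left := by
  have hle : ∀ τ : Δ.cones, τ ≤ ⟨σ, h.1⟩ := fun τ => by
    rcases (h.2 τ.1).1 τ.2 with hτ | ⟨u, -, hτ⟩
    · exact hτ.le
    · exact fun v hv => ((hτ v).1 hv).1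
  have hT : IsTerminal (⟨σ, h.1⟩ : Δ.cones) :=
    IsTerminal.ofUniqueHom (fun τ => homOfLE (hle τ)) fun _ _ => Subsingleton.elim _ _
  -- The largest cone is terminal in the gluing diagram, so the colimit is `U_σ` itself.
  have : IsIso (Δ.ι k ⟨σ, h.1⟩).left := isIso_ι_of_isTerminal hT (Δ.diagram k)
  have : IsAffine (affineToricVariety k σ).left :=
    inferInstanceAs (IsAffine (Spec (.of (SemigroupRing k σ))))
  exact .of_isIso (inv (Δ.ι k ⟨σ, h.1⟩).left)

end Semigroup

end Toric

/-- If the toric variety `X(Δ)` of a fan `Δ` carries a structure of a toric semigroup, then `Δ` is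
generated by a single cone; in particular, `X(Δ)` is affine. -/
theorem theorem3p1 {k : Type u} [Field k] [IsAlgClosed k]
    {N : Type u} [AddCommGroup N] [Module.Free ℤ N] [Module.Finite ℤ N] (Δ : Toric.Fan N)
    (h : Nonempty (Toric.ToricSemigroup k Δ)) :
    (∃ σ ∈ Δ.cones, Δ.IsGeneratedBy σ) ∧ IsAffine (Δ.toricVariety k).left := by
  obtain ⟨s⟩ := h
  obtain ⟨σ, hσ, hgen⟩ := Δ.exists_isGeneratedBy fun σ hσ τ hτ => by
    obtain ⟨ρ, h1, h2⟩ := s.exists_le_le ⟨σ, hσ⟩ ⟨τ, hτ⟩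
    exact ⟨ρ.1, ρ.2, h1, h2⟩
  exact ⟨⟨σ, hσ, hgen⟩, hgen.isAffine⟩
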